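/- Let $d\ge 0$, $k\ge 1$ and $n=d+1+k$. Let $a_1,\dots,a_n\in\mathbb{Z}^d$ and let $A\in\mathbb{Z}^{(d+1)\times n}$ be the matrix with columns $(1,a_1),\dots,(1,a_n)$. Let $C\in\mathbb{R}^{d\times n}$. Assume that $A$ and $C$ are uniform (no maximal minor vanishes) and that $\mathbf 0$ is a linear combination of the columns of $C$ with all coefficients strictly positive. A matrix $N$ is called Gale dual to a real matrix $M$ of maximal rank if the columns of $N$ form a basis of the real kernel of $M$. Let $B\in\mathbb{Z}^{n\times k}$ be a Gale dual matrix of $A$, let $\mathcal L_B\subset\mathbb{Z}^n$ be the lattice generated over $\mathbb{Z}$ by the columns of $B$, and assume that the lattice ideal $$I_{\mathcal L_B}=\langle x^{u^+}-x^{u^-} : u\in\mathcal L_B\rangle\subset\mathbb{R}[x_1,\dots,x_n]$$ (where $u=u^+-u^-$ is the decomposition into positive and negative parts) is a complete intersection, that is, it can be generated by as many polynomials as its codimension (height). Then there is a Gale dual matrix $B'\in\mathbb{Z}^{n\times k}$ of $A$ with the following property. Let $D\in\mathbb{R}^{n\times(k+1)}$ be any Gale dual matrix of $C$, with rows $P_1,\dots,P_n$,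 such that $$\Delta_P=\{y=(y_0,\dots,y_k)\in\mathbb{R}^{k+1} : y_0=1,\ \langle P_i,y\rangle>0 \text{ for } i=1,\dots,n\}$$ is bounded and of full dimension $k$. Let $I_C$ be the set of indices $i$ such that $P_i$ does not lie in the closed convex cone generated by the $P_j$ with $j\ne i$ (the minimal generators of the cone generated by $P_1,\dots,P_n$). For $i\in I_C$ let $F_i=\overline{\Delta_P}\cap\{y:\langle P_i,y\rangle=0\}$. Then for every non-empty $L\subset I_C$ such that $F_L=\bigcap_{i\in L}F_i$ is a non-empty face of $\overline{\Delta_P}$, the submatrix $B'_L\in\mathbb{Z}^{|L|\times k}$ of $B'$ formed by the rows with index in $L$ is not weakly mixed, i.e. it has a nonzero column whose entries are all $\ge 0$ or all $\le 0$. -/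

import Mathlib

open scoped Matrix

noncomputable section

/-- No maximal minor of the (wide) matrix `M` vanishes. -/
def IsUniformMatrix {R : Type*} [CommRing R] {r s : ℕ} (M : Matrix (Fin r) (Fin s) R) : Prop :=
  ∀ f : Fin r ↪o Fin s, (M.submatrix id f).det ≠ 0

/-- `N` is Gale dual to `M`: the columns of `N` form a basis of the real kernel of `M`. -/
def IsGaleDual {r s t : ℕ} (M : Matrix (Fin r) (Fin s) ℝ) (N : Matrix (Fin s) (Fin t) ℝ) : Prop :=
  LinearIndependent ℝ N.col ∧ Submodule.span ℝ (Set.range N.col) = LinearMap.ker M.mulVecLin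

/-- An integer matrix viewed as a real matrix. -/
abbrev realMatrix {m n : ℕ} (M : Matrix (Fin m) (Fin n) ℤ) : Matrix (Fin m) (Fin n) ℝ :=
  M.map (Int.cast : ℤ → ℝ)

/-- The matrix with columns `(1, a 0), …, (1, a (n - 1))` of an integer point configuration. -/
def configMatrix {d n : ℕ} (a : Fin n → Fin d → ℤ) : Matrix (Fin (d + 1)) (Fin n) ℤ :=
  Matrix.of fun i j => (Fin.cons 1 (a j) : Fin (d + 1) → ℤ) i

/-! ### Lattice ideals and complete intersections -/

/-- The lattice `ℤ B` spanned by the columns of `B`. -/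
def columnLattice {n k : ℕ} (B : Matrix (Fin n) (Fin k) ℤ) : AddSubgroup (Fin n → ℤ) :=
  AddSubgroup.closure (Set.range B.col)

/-- The binomial `x ^ u⁺ - x ^ u⁻`, where `u = u⁺ - u⁻` with `u⁺`, `u⁻` the positive and
negative parts. -/
def latticeBinomial {n : ℕ} (u : Fin n → ℤ) : MvPolynomial (Fin n) ℝ :=
  ∏ i, MvPolynomial.X i ^ (u i).toNat - ∏ i, MvPolynomial.X i ^ (-u i).toNat

/-- The lattice ideal of `L`. -/
def latticeIdeal {n : ℕ} (L : AddSubgroup (Fin n → ℤ)) : Ideal (MvPolynomial (Fin n) ℝ) :=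
  Ideal.span {p | ∃ u ∈ L, p = latticeBinomial u}

/-- The ideal `I` of a polynomial ring can be generated by as many polynomials as its
codimension. -/
def IsCompleteIntersectionIdeal {n : ℕ} (I : Ideal (MvPolynomial (Fin n) ℝ)) : Prop :=
  ∃ S : Finset (MvPolynomial (Fin n) ℝ),
    Ideal.span (S : Set (MvPolynomial (Fin n) ℝ)) = I ∧ (S.card : ℕ∞) = I.height

/-! ### Cones and polytopes attached to the rows of a matrix -/

/-- The set of all strictly positive linear combinations of the columns of `C`. -/
def positiveColumnCone {d n : ℕ} (C : Matrix (Fin d) (Fin n) ℝ) : Set (Fin d → ℝ) :=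
  {v | ∃ z : Fin n → ℝ, (∀ j, 0 < z j) ∧ v = ∑ j, z j • C.col j}

/-- The open dual cone `{y | ⟨P_i, y⟩ > 0 for all i}` of the rows `P_i` of `D`. -/
def openDualCone {n k : ℕ} (D : Matrix (Fin n) (Fin (k + 1)) ℝ) : Set (Fin (k + 1) → ℝ) :=
  {y | ∀ i, 0 < D i ⬝ᵥ y}

/-- The polytope `Δ_P`, the slice `y_0 = 1` of the open dual cone. -/
def galePolytope {n k : ℕ} (D : Matrix (Fin n) (Fin (k + 1)) ℝ) : Set (Fin (k + 1) → ℝ) :=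
  openDualCone D ∩ {y | y 0 = 1}

/-- `Δ_P` has dimension `k`, the dimension of the hyperplane `y_0 = 1` containing it. -/
def IsFullDimensionalGalePolytope {n k : ℕ} (D : Matrix (Fin n) (Fin (k + 1)) ℝ) : Prop :=
  (galePolytope D).Nonempty ∧ Module.finrank ℝ (vectorSpan ℝ (galePolytope D)) = k

/-- Indices of the minimal set of generators of the polyhedral cone generated by the rows of `D`:
the rows that are not in the cone generated by the other rows. -/
def minimalGenerators {n k : ℕ} (D : Matrix (Fin n) (Fin (k + 1)) ℝ) : Set (Fin n) :=
  {i | ¬ ∃ z : Fin n → ℝ, (∀ j, 0 ≤ z j) ∧ z i = 0 ∧ D i = ∑ j, z j • D j}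

/-- The facet of (the closure of) `Δ_P` supported on the hyperplane `⟨P_i, y⟩ = 0`. -/
def galeFacet {n k : ℕ} (D : Matrix (Fin n) (Fin (k + 1)) ℝ) (i : Fin n) :
    Set (Fin (k + 1) → ℝ) :=
  closure (galePolytope D) ∩ {y | D i ⬝ᵥ y = 0}

/-- The sets `L` of facets whose intersection `F_L` is a face of (the closure of) `Δ_P`.
As usual `L` is a non-empty set of indices of facets, and the empty set is not a face. -/
def faceIndexSets {n k : ℕ} (D : Matrix (Fin n) (Fin (k + 1)) ℝ) : Set (Set (Fin n)) :=
  {L | L.Nonempty ∧ L ⊆ minimalGenerators D ∧ (⋂ i ∈ L, galeFacet D i).Nonempty ∧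
    IsExposed ℝ (closure (galePolytope D)) (⋂ i ∈ L, galeFacet D i)}

/-! ### Weakly mixed matrices -/

/-- Every column either is zero or contains a positive and a negative entry. -/
def IsWeaklyMixed {ι κ : Type*} (M : Matrix ι κ ℝ) : Prop :=
  ∀ j, (∀ i, M i j = 0) ∨ ((∃ i, 0 < M i j) ∧ ∃ i, M i j < 0)

/-- For every `L` such that `F_L` is a face of `Δ_P`, the submatrix `B_L` of the rows of `B`
with indices in `L` is not weakly mixed. -/
def FaceSubmatricesNotWeaklyMixed {n k : ℕ} (B : Matrix (Fin n) (Fin k) ℝ)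
    (D : Matrix (Fin n) (Fin (k + 1)) ℝ) : Prop :=
  ∀ L ∈ faceIndexSets D, ¬ IsWeaklyMixed (B.submatrix (Subtype.val : L → Fin n) id)

end

/-! The columns of `B'` are exponents of k binomials generating the lattice ideal I. They exist
because I is homogeneous (the row of ones in A makes the coordinates of lattice vectors sum to 0),
so graded Nakayama extracts from all lattice binomials at most as many generators as the complete
intersection has. The height of I is at most k, and a generating set of binomials spans the rank k
lattice, so exactly k remain (`exists_basis_of_isCompleteIntersectionIdeal`). Suppose `B'_L` is
weakly mixed, and let T index its nonzero columns. A common zero of the rows of D in L with y_0 = 1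
and uniformity of C give |L| ≤ k; uniformity of A then gives |L| ≤ |T| (`card_le_card_of_uniform`).
But both monomials of a binomial in T contain a variable from L, so I lies in the ideal generated by
those variables and the binomials outside T, at most k - |T| + |L| ≤ k elements. A minimal prime of
that ideal has height at most that of I, so it is minimal over I; yet variables are nonzerodivisors
modulo I (`card_lt_card_of_mixed_of_height`). -/

namespace MvPolynomial

variable {σ K : Type*} [Field K]

/-! ### Minimal generators of homogeneous ideals -/

section Graded

attribute [local instance] MvPolynomial.gradedAlgebra

/-- Graded Nakayama lemma for homogeneous ideals of a polynomial ring. -/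
theorem le_of_le_sup_idealOfVars_mul {I J : Ideal (MvPolynomial σ K)}
    (hI : I.IsHomogeneous (homogeneousSubmodule σ K))
    (hJ : J.IsHomogeneous (homogeneousSubmodule σ K))
    (h : I ≤ J ⊔ idealOfVars σ K * I) : I ≤ J := by
  have key : ∀ e : ℕ, I ≤ J ⊔ idealOfVars σ K ^ e * I := by
    intro e
    induction e with
    | zero => simp
    | succ e ih =>
      refine h.trans (sup_le le_sup_left ?_)
      refine (Ideal.mul_mono_right ih).trans ?_
      rw [Ideal.mul_sup, ← mul_assoc, ← pow_succ']
      exact sup_le_sup_right Ideal.mul_le_right _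
  intro f hf
  rw [mem_iff_homogeneousComponent_mem hJ]
  intro e
  -- Elements of the (e+1)-st power of the irrelevant ideal have no component of degree e, so r
  -- drops out.
  obtain ⟨g, hg, r, hr, hgr⟩ := Submodule.mem_sup.1
    (key (e + 1) (homogeneousComponent_mem_of_mem hI hf e))
  have hr0 : homogeneousComponent e r = 0 := by
    have := (mem_pow_idealOfVars_iff _ _).1 (Ideal.mul_le_left hr)
    exact homogeneousComponent_eq_zero' _ _ fun d hd => by have := this d hd; omega
  have := congrArg (homogeneousComponent e) hgr
  rw [map_add, hr0, add_zero, homogeneousComponent_eq_self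
    (homogeneousComponent_isHomogeneous e f)] at this
  rw [← this]
  exact homogeneousComponent_mem_of_mem hJ hg e

theorem isHomogeneous_span_range {ι : Type*} {v : ι → MvPolynomial σ K} {e : ι → ℕ}
    (hv : ∀ i, (v i).IsHomogeneous (e i)) :
    (Ideal.span (Set.range v)).IsHomogeneous (homogeneousSubmodule σ K) := by
  refine Ideal.homogeneous_span _ _ ?_
  rintro _ ⟨i, rfl⟩
  exact ⟨e i, hv i⟩

theorem sub_C_constantCoeff_mem_idealOfVars (p : MvPolynomial σ K) :
    p - C (constantCoeff p) ∈ idealOfVars σ K := by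
  rw [← pow_one (idealOfVars σ K), mem_pow_idealOfVars_iff']
  intro x hx
  have : x = 0 := by rw [← Finsupp.degree_eq_zero_iff]; omega
  subst this
  simp [constantCoeff_eq]

/-- Only the constant term of a coefficient survives modulo 𝔪I, so generators of I span I/𝔪I over K.
-/
theorem span_le_span_sup_idealOfVars_mul (s : Set (MvPolynomial σ K)) :
    (Ideal.span s).restrictScalars K ≤
      Submodule.span K s ⊔ (idealOfVars σ K * Ideal.span s).restrictScalars K := by
  intro f hf
  induction (show f ∈ Submodule.span _ s from hf) using Submodule.span_induction with
  | mem x hx => exact Submodule.mem_sup_left (Submodule.subset_span hx)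
  | zero => exact zero_mem _
  | add x y hx hy ihx ihy => exact add_mem (ihx hx) (ihy hy)
  | smul a x hx ih =>
    have : a • x = constantCoeff a • x + (a - C (constantCoeff a)) * x := by
      rw [smul_eq_mul, smul_eq_C_mul]; ring
    rw [this]
    exact add_mem (Submodule.smul_mem _ _ (ih hx)) (Submodule.mem_sup_right
      (Ideal.mul_mem_mul (sub_C_constantCoeff_mem_idealOfVars a) hx))

/-- A homogeneous generating family of an ideal contains a generating subfamily with at most as
many elements as any other generating set. -/
theorem exists_subfamily_span_eq {ι : Type*} {v : ι → MvPolynomial σ K} {e : ι → ℕ}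
    (hv : ∀ i, (v i).IsHomogeneous (e i)) (S : Finset (MvPolynomial σ K))
    (hS : Ideal.span (S : Set (MvPolynomial σ K)) = Ideal.span (Set.range v)) :
    ∃ (c : ℕ) (a : Fin c → ι), c ≤ S.card ∧
      Ideal.span (Set.range (v ∘ a)) = Ideal.span (Set.range v) := by
  classical
  set I := Ideal.span (Set.range v)
  let M : Submodule K (MvPolynomial σ K) := (idealOfVars σ K * I).restrictScalars K
  have hspan : ∀ s : Set (MvPolynomial σ K), Ideal.span s = I →
      Submodule.span K (M.mkQ '' s) = (I.restrictScalars K).map M.mkQ := by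
    intro s hs
    rw [← Submodule.map_span]
    apply le_antisymm
    · refine Submodule.map_mono (Submodule.span_le.2 ?_)
      rw [← hs]
      exact Ideal.subset_span
    · refine (Submodule.map_mono (hs ▸ span_le_span_sup_idealOfVars_mul s)).trans ?_
      rw [Submodule.map_sup]
      refine sup_le le_rfl ?_
      exact (Submodule.mkQ_map_self M).le.trans bot_le
  -- A subfamily of v that is a basis of I/𝔪I; S also spans this space, which bounds its size.
  obtain ⟨κ, a, ha, hsp, hli⟩ := exists_linearIndependent' K (M.mkQ ∘ v)
  have hspV := hspan _ (rfl : Ideal.span (Set.range v) = I)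
  have hspS := hspan _ hS
  rw [← Set.range_comp, ← hsp, ← hspS] at hspV
  have hfin : Module.Finite K (Submodule.span K (M.mkQ '' (S : Set (MvPolynomial σ K)))) :=
    Module.Finite.span_of_finite K (S.finite_toSet.image _)
  have hli' : LinearIndependent K (fun i => (⟨((M.mkQ ∘ v) ∘ a) i,
      hspV ▸ Submodule.subset_span ⟨i, rfl⟩⟩ :
        Submodule.span K (M.mkQ '' (S : Set (MvPolynomial σ K))))) :=
    LinearIndependent.of_comp (Submodule.subtype _) hli
  have : Finite κ := hli'.finite
  have := Fintype.ofFinite κ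
  have hcard : Fintype.card κ ≤ S.card := by
    refine hli'.fintype_card_le_finrank.trans ?_
    rw [← Finset.coe_image]
    exact (finrank_span_finset_le_card _).trans Finset.card_image_le
  refine ⟨Fintype.card κ, a ∘ (Fintype.equivFin κ).symm, hcard, ?_⟩
  have hr : Set.range (v ∘ a ∘ (Fintype.equivFin κ).symm) = Set.range (v ∘ a) := by
    rw [← Function.comp_assoc, (Fintype.equivFin κ).symm.surjective.range_comp]
  rw [hr]
  apply le_antisymm
  · exact Ideal.span_mono (Set.range_comp_subset_range _ _)
  · refine le_of_le_sup_idealOfVars_mul (isHomogeneous_span_range hv)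
      (isHomogeneous_span_range fun i => hv (a i)) ?_
    intro f hf
    have hmem : M.mkQ f ∈ Submodule.span K (Set.range ((M.mkQ ∘ v) ∘ a)) := by
      rw [hspV, hspS]
      exact Submodule.mem_map_of_mem hf
    rw [Function.comp_assoc, Set.range_comp, ← Submodule.map_span] at hmem
    obtain ⟨g, hg, hgf⟩ := hmem
    have hgI : g ∈ Ideal.span (Set.range (v ∘ a)) :=
      Submodule.span_le_restrictScalars K (MvPolynomial σ K) _ hg
    have hfg : f - g ∈ M := by
      rw [← Submodule.ker_mkQ M, LinearMap.mem_ker, map_sub, hgf, sub_self]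
    rw [← add_sub_cancel g f]
    exact add_mem (Submodule.mem_sup_left hgI) (Submodule.mem_sup_right hfg)

end Graded

end MvPolynomial

/-! ### Lattice ideals: kernel description, variables, heights -/

section LatticeIdeal

open MvPolynomial

variable {n : ℕ}

theorem prod_X_pow_eq_monomial_equivFunOnFinite (e : Fin n → ℕ) :
    ∏ i, (X i : MvPolynomial (Fin n) ℝ) ^ e i = monomial (Finsupp.equivFunOnFinite.symm e) 1 := by
  rw [monomial_eq, C_1, one_mul, Finsupp.prod_fintype _ _ (by simp)]
  rfl

theorem latticeBinomial_isHomogeneous {u : Fin n → ℤ} (hu : ∑ i, u i = 0) :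
    (latticeBinomial u).IsHomogeneous (∑ i, (u i).toNat) := by
  have h : ∑ i, (u i).toNat = ∑ i, (-u i).toNat := by
    zify
    rw [← sub_eq_zero, ← Finset.sum_sub_distrib, ← hu]
    exact Finset.sum_congr rfl fun i _ => by omega
  refine IsHomogeneous.sub (IsHomogeneous.prod _ _ _ fun i _ => isHomogeneous_X_pow _ _) ?_
  rw [h]
  exact IsHomogeneous.prod _ _ _ fun i _ => isHomogeneous_X_pow _ _

theorem latticeBinomial_mem_of_mixed {u : Fin n → ℤ} {J : Ideal (MvPolynomial (Fin n) ℝ)}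
    {s : Set (Fin n)} (hs : ∀ i ∈ s, X i ∈ J) (hpos : ∃ i ∈ s, 0 < u i) (hneg : ∃ i ∈ s, u i < 0) :
    latticeBinomial u ∈ J := by
  obtain ⟨i, hi, hui⟩ := hpos
  obtain ⟨j, hj, huj⟩ := hneg
  refine sub_mem ?_ ?_
  · exact Ideal.prod_mem J (Finset.mem_univ i) (Ideal.pow_mem_of_mem _ (hs i hi) _ (by omega))
  · exact Ideal.prod_mem J (Finset.mem_univ j) (Ideal.pow_mem_of_mem _ (hs j hj) _ (by omega))

/-- The grading of the polynomial ring by the classes of exponents modulo `L`, as the algebra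
homomorphism to the group algebra of `ℤⁿ / L` that maps each variable to the class of the
corresponding unit vector. -/
noncomputable def latticeClassHom (L : AddSubgroup (Fin n → ℤ)) :
    MvPolynomial (Fin n) ℝ →ₐ[ℝ] AddMonoidAlgebra ℝ ((Fin n → ℤ) ⧸ L) :=
  aeval fun i => AddMonoidAlgebra.single (QuotientAddGroup.mk (Pi.single i 1)) 1

theorem latticeClassHom_monomial (L : AddSubgroup (Fin n → ℤ)) (m : Fin n →₀ ℕ) (c : ℝ) :
    latticeClassHom L (monomial m c) =
      AddMonoidAlgebra.single (QuotientAddGroup.mk fun i => (m i : ℤ)) c := by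
  have h : ∀ s : Finset (Fin n), ∏ i ∈ s, (AddMonoidAlgebra.single
      (QuotientAddGroup.mk (Pi.single i 1) : (Fin n → ℤ) ⧸ L) (1 : ℝ)) ^ m i =
      AddMonoidAlgebra.single
        (QuotientAddGroup.mk (∑ i ∈ s, m i • (Pi.single i 1 : Fin n → ℤ))) 1 := by
    intro s
    induction s using Finset.cons_induction with
    | empty => simp [AddMonoidAlgebra.one_def]
    | cons a s ha ih =>
      rw [Finset.prod_cons, Finset.sum_cons, ih, AddMonoidAlgebra.single_pow,
        AddMonoidAlgebra.single_mul_single]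
      simp
  rw [latticeClassHom, aeval_monomial, Finsupp.prod_fintype _ _ (by simp), h,
    ← Algebra.smul_def, AddMonoidAlgebra.smul_single]
  congr 2
  · ext j
    simp [Finset.sum_apply, Pi.single_apply]
  · simp

theorem latticeClassHom_latticeBinomial (L : AddSubgroup (Fin n → ℤ)) (u : Fin n → ℤ) :
    latticeClassHom L (latticeBinomial u) = 0 ↔ u ∈ L := by
  rw [latticeBinomial, prod_X_pow_eq_monomial_equivFunOnFinite,
    prod_X_pow_eq_monomial_equivFunOnFinite, map_sub, latticeClassHom_monomial,
    latticeClassHom_monomial, sub_eq_zero, AddMonoidAlgebra.single_left_inj one_ne_zero,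
    eq_comm, QuotientAddGroup.eq]
  convert! Iff.rfl using 2
  ext i
  simp
  omega

theorem monomial_sub_monomial_mem_latticeIdeal {L : AddSubgroup (Fin n → ℤ)} {m m' : Fin n →₀ ℕ}
    (h : (fun i => (m i : ℤ) - m' i) ∈ L) :
    (monomial m 1 - monomial m' 1 : MvPolynomial (Fin n) ℝ) ∈ latticeIdeal L := by
  have : (monomial m 1 - monomial m' 1 : MvPolynomial (Fin n) ℝ) =
      monomial (m ⊓ m') 1 * latticeBinomial fun i => (m i : ℤ) - m' i := by
    rw [latticeBinomial, prod_X_pow_eq_monomial_equivFunOnFinite,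
      prod_X_pow_eq_monomial_equivFunOnFinite, mul_sub, monomial_mul, monomial_mul, one_mul]
    congr 2 <;>
    · congr 1
      ext i
      simp
      omega
  rw [this]
  exact Ideal.mul_mem_left _ _ (Ideal.subset_span ⟨_, h, rfl⟩)

theorem ker_latticeClassHom (L : AddSubgroup (Fin n → ℤ)) :
    RingHom.ker (latticeClassHom L) = latticeIdeal L := by
  classical
  apply le_antisymm
  -- Choosing one monomial per class gives a normal form: f is congruent to the lift of its image.
  · let r : (Fin n → ℤ) ⧸ L → MvPolynomial (Fin n) ℝ := fun q =>
      if h : ∃ m : Fin n →₀ ℕ, QuotientAddGroup.mk (fun i => (m i : ℤ)) = q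
      then monomial h.choose 1 else 0
    have key : ∀ f : MvPolynomial (Fin n) ℝ,
        f - Finsupp.linearCombination ℝ r (latticeClassHom L f).coeff ∈ latticeIdeal L := by
      intro f
      induction f using MvPolynomial.induction_on' with
      | monomial m c =>
        have hm : ∃ m' : Fin n →₀ ℕ, (QuotientAddGroup.mk (fun i => (m' i : ℤ)) :
            (Fin n → ℤ) ⧸ L) = QuotientAddGroup.mk (fun i => (m i : ℤ)) := ⟨m, rfl⟩
        rw [latticeClassHom_monomial, AddMonoidAlgebra.coeff_single,
          Finsupp.linearCombination_single]
        simp only [r, dif_pos hm]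
        have : monomial m c = c • (monomial m 1 : MvPolynomial (Fin n) ℝ) := by
          simp [smul_monomial]
        rw [this, ← smul_sub, smul_eq_C_mul]
        refine Ideal.mul_mem_left _ _ (monomial_sub_monomial_mem_latticeIdeal ?_)
        have := QuotientAddGroup.eq.1 hm.choose_spec
        convert! this using 1
        ext i
        simp
        omega
      | add p q hp hq =>
        rw [map_add, AddMonoidAlgebra.coeff_add, map_add, add_sub_add_comm]
        exact add_mem hp hq
    intro f hf
    have := key f
    rwa [(RingHom.mem_ker).1 hf, AddMonoidAlgebra.coeff_zero, map_zero, sub_zero] at this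
  · refine Ideal.span_le.2 ?_
    rintro _ ⟨u, hu, rfl⟩
    exact (latticeClassHom_latticeBinomial L u).2 hu

theorem latticeBinomial_mem_latticeIdeal_iff {L : AddSubgroup (Fin n → ℤ)} {u : Fin n → ℤ} :
    latticeBinomial u ∈ latticeIdeal L ↔ u ∈ L := by
  rw [← ker_latticeClassHom, RingHom.mem_ker]
  exact latticeClassHom_latticeBinomial L u

/-- Variables become units in the group algebra, hence are nonzerodivisors modulo the lattice ideal.
-/
theorem mem_latticeIdeal_of_X_mul_mem {L : AddSubgroup (Fin n → ℤ)} {i : Fin n}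
    {f : MvPolynomial (Fin n) ℝ} (h : X i * f ∈ latticeIdeal L) : f ∈ latticeIdeal L := by
  rw [← ker_latticeClassHom, RingHom.mem_ker, map_mul] at *
  have hu : IsUnit (latticeClassHom L (X i)) := by
    refine IsUnit.of_mul_eq_one
      (AddMonoidAlgebra.single (-QuotientAddGroup.mk (Pi.single i 1)) 1) ?_
    rw [latticeClassHom, aeval_X, AddMonoidAlgebra.single_mul_single, AddMonoidAlgebra.one_def]
    simp
  exact hu.mul_right_eq_zero.1 h

theorem X_notMem_of_mem_minimalPrimes_latticeIdeal {L : AddSubgroup (Fin n → ℤ)}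
    {Q : Ideal (MvPolynomial (Fin n) ℝ)} (hQ : Q ∈ (latticeIdeal L).minimalPrimes) (i : Fin n) :
    X i ∉ Q := by
  intro h
  obtain ⟨y, hy, hxy⟩ := Ideal.exists_mul_mem_of_mem_minimalPrimes hQ h
  exact hy (mem_latticeIdeal_of_X_mul_mem hxy)

theorem mem_closure_of_latticeIdeal_le_span {L : AddSubgroup (Fin n → ℤ)} {s : Set (Fin n → ℤ)}
    (h : latticeIdeal L ≤ Ideal.span (latticeBinomial '' s)) : L ≤ AddSubgroup.closure s := by
  intro u hu
  rw [← latticeBinomial_mem_latticeIdeal_iff]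
  refine (h.trans (Ideal.span_mono ?_)) (latticeBinomial_mem_latticeIdeal_iff.2 hu)
  rintro _ ⟨w, hw, rfl⟩
  exact ⟨w, AddSubgroup.subset_closure hw, rfl⟩

/-- The exponents `u` whose binomial lies in a prime ideal containing no variable form a group. -/
theorem latticeIdeal_closure_le {Q : Ideal (MvPolynomial (Fin n) ℝ)} [Q.IsPrime]
    (hX : ∀ i, X i ∉ Q) {s : Set (Fin n → ℤ)} (hs : ∀ u ∈ s, latticeBinomial u ∈ Q) :
    latticeIdeal (AddSubgroup.closure s) ≤ Q := by
  let F := FractionRing (MvPolynomial (Fin n) ℝ ⧸ Q)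
  let φ : MvPolynomial (Fin n) ℝ →+* F :=
    (algebraMap (MvPolynomial (Fin n) ℝ ⧸ Q) F).comp (Ideal.Quotient.mk Q)
  have hφ : ∀ f, φ f = 0 ↔ f ∈ Q := fun f => by
    simp only [φ, RingHom.comp_apply]
    rw [map_eq_zero_iff _ (IsFractionRing.injective _ _), Ideal.Quotient.eq_zero_iff_mem]
  have hX0 : ∀ i, φ (X i) ≠ 0 := fun i h => hX i ((hφ _).1 h)
  have hmem : ∀ u, latticeBinomial u ∈ Q ↔ ∏ i, φ (X i) ^ u i = 1 := by
    intro u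
    rw [← hφ, latticeBinomial, map_sub, map_prod, map_prod, sub_eq_zero]
    have : ∀ i, φ (X i) ^ u i = φ (X i ^ (u i).toNat) / φ (X i ^ (-u i).toNat) := fun i => by
      rw [map_pow, map_pow, ← zpow_natCast, ← zpow_natCast, ← zpow_sub₀ (hX0 i)]
      congr 1
      omega
    rw [Finset.prod_congr rfl fun i _ => this i, Finset.prod_div_distrib, div_eq_one_iff_eq]
    exact Finset.prod_ne_zero_iff.2 fun i _ => by simpa using fun h => absurd h (hX0 i)
  refine Ideal.span_le.2 ?_
  rintro _ ⟨u, hu, rfl⟩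
  rw [SetLike.mem_coe, hmem]
  induction hu using AddSubgroup.closure_induction with
  | mem x hx => exact (hmem x).1 (hs x hx)
  | zero => simp
  | add x y _ _ hx hy =>
    simp only [Pi.add_apply, zpow_add₀ (hX0 _), Finset.prod_mul_distrib, hx, hy, mul_one]
  | neg x _ hx => simp [hx]

theorem height_latticeIdeal_closure_le {s : Set (Fin n → ℤ)} (hs : s.Finite) :
    (latticeIdeal (AddSubgroup.closure s)).height ≤ s.ncard := by
  let J : Ideal (MvPolynomial (Fin n) ℝ) := Ideal.span (latticeBinomial '' s)
  -- All binomials vanish at (1,…,1), so some minimal prime of J lies in M and contains no variable.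
  let M : Ideal (MvPolynomial (Fin n) ℝ) := RingHom.ker (eval fun _ => (1 : ℝ))
  have hM : M.IsPrime := RingHom.ker_isPrime _
  have hJM : J ≤ M := by
    refine Ideal.span_le.2 ?_
    rintro _ ⟨u, -, rfl⟩
    simp [M, RingHom.mem_ker, latticeBinomial]
  obtain ⟨Q, hQ, hQM⟩ := Ideal.exists_minimalPrimes_le hJM
  have := hQ.isPrime
  have hX : ∀ i, X i ∉ Q := fun i hi => by simpa [M, RingHom.mem_ker] using hQM hi
  have hle := latticeIdeal_closure_le hX fun u hu => hQ.le (Ideal.subset_span ⟨u, hu, rfl⟩)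
  refine (Ideal.height_mono hle).trans
    ((Ideal.height_le_card_of_mem_minimalPrimes_span (hs.image _) hQ).trans ?_)
  exact_mod_cast Set.ncard_image_le hs

/-- The exponent vectors `w` of binomials that generate a lattice ideal as a complete intersection
are mixed dominating: if the rows in `R` of the vectors indexed by `T` all contain entries of both
signs, then `T` has fewer elements than `R`. -/
theorem card_lt_card_of_mixed_of_height {L : AddSubgroup (Fin n → ℤ)} {k : ℕ}
    (w : Fin k → Fin n → ℤ)
    (hw : Ideal.span (Set.range fun j => latticeBinomial (w j)) = latticeIdeal L)
    (hht : (k : ℕ∞) ≤ (latticeIdeal L).height)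
    (R : Finset (Fin n)) (hR : R.Nonempty) (T : Finset (Fin k))
    (hT : ∀ j ∈ T, (∃ i ∈ R, 0 < w j i) ∧ ∃ i ∈ R, w j i < 0)
    (hsum : ∀ j, ∑ i, w j i = 0) : T.card < R.card := by
  classical
  by_contra! hcard
  let G : Finset (MvPolynomial (Fin n) ℝ) :=
    Tᶜ.image (fun j => latticeBinomial (w j)) ∪ R.image X
  let J := Ideal.span (G : Set (MvPolynomial (Fin n) ℝ))
  have hXJ : ∀ i ∈ R, X i ∈ J := fun i hi => Ideal.subset_span (by
    simp only [G, Finset.coe_union, Finset.coe_image]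
    exact Or.inr ⟨i, hi, rfl⟩)
  have hIJ : latticeIdeal L ≤ J := by
    rw [← hw, Ideal.span_le]
    rintro _ ⟨j, rfl⟩
    by_cases hj : j ∈ T
    · exact latticeBinomial_mem_of_mixed (s := R) hXJ (hT j hj).1 (hT j hj).2
    · refine Ideal.subset_span ?_
      simp only [G, Finset.coe_union, Finset.coe_image]
      exact Or.inl ⟨j, by simpa using hj, rfl⟩
  -- All generators vanish at the origin: a nonzero exponent with sum 0 has entries of both signs.
  have hJ : J ≠ ⊤ := by
    have hle : J ≤ RingHom.ker (constantCoeff : MvPolynomial (Fin n) ℝ →+* ℝ) := by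
      rw [Ideal.span_le]
      intro p hp
      simp only [G, Finset.coe_union, Finset.coe_image] at hp
      rcases hp with ⟨j, -, rfl⟩ | ⟨i, -, rfl⟩
      · by_cases h0 : ∀ i, w j i = 0
        · simp [latticeBinomial, h0]
        · push Not at h0
          obtain ⟨i, hi⟩ := h0
          obtain ⟨p, -, hp⟩ := Finset.exists_pos_of_sum_zero_of_exists_nonzero _ (hsum j)
            ⟨i, Finset.mem_univ i, hi⟩
          obtain ⟨q, -, hq⟩ := Finset.exists_pos_of_sum_zero_of_exists_nonzero (fun i => - w j i)
            (by simp [hsum j]) ⟨i, Finset.mem_univ i, by simpa using hi⟩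
          exact latticeBinomial_mem_of_mixed (s := Set.univ) (by simp [RingHom.mem_ker])
            ⟨p, trivial, hp⟩ ⟨q, trivial, by simpa using hq⟩
      · simp [RingHom.mem_ker]
    intro h
    rw [h, top_le_iff] at hle
    exact (RingHom.ker_ne_top _) hle
  obtain ⟨Q, hQ⟩ := Ideal.nonempty_minimalPrimes hJ
  have := hQ.isPrime
  have hG : G.card ≤ k := by
    refine (Finset.card_union_le _ _).trans ?_
    have h1 : (Tᶜ.image (fun j => latticeBinomial (w j))).card ≤ k - T.card :=
      Finset.card_image_le.trans (by simp [Finset.card_compl])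
    have h2 : (R.image (X : _ → MvPolynomial (Fin n) ℝ)).card ≤ R.card := Finset.card_image_le
    have h3 : T.card ≤ k := by simpa using T.card_le_univ
    omega
  have hQht : Q.height ≤ (latticeIdeal L).height :=
    (Ideal.height_le_card_of_mem_minimalPrimes_span_finset hQ).trans
      (le_trans (by exact_mod_cast hG) hht)
  obtain ⟨i, hi⟩ := hR
  exact X_notMem_of_mem_minimalPrimes_latticeIdeal
    (Ideal.mem_minimalPrimes_of_height_le (hIJ.trans hQ.le) hQht) i (hQ.le (hXJ i hi))

end LatticeIdeal

/-! ### Uniformity, Gale duals and the lattice basis -/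

section GaleDuality

/-- The support of v fits into r columns, which form an invertible minor. -/
theorem eq_zero_of_mulVec_eq_zero_of_isUniformMatrix {r s : ℕ} {M : Matrix (Fin r) (Fin s) ℝ}
    (hM : IsUniformMatrix M) {v : Fin s → ℝ} (hv : M *ᵥ v = 0) {R : Finset (Fin s)}
    (hR : ∀ i ∈ R, v i = 0) (hcard : s ≤ R.card + r) (hrs : r ≤ s) : v = 0 := by
  classical
  obtain ⟨t, hRt, ht⟩ : ∃ t, Rᶜ ⊆ t ∧ t.card = r :=
    Finset.exists_superset_card_eq (by rw [Finset.card_compl, Fintype.card_fin]; omega)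
      (by simpa using hrs)
  have hzero : ∀ j ∉ t, v j = 0 := fun j hj => hR j (by_contra fun h => hj (hRt (by simpa using h)))
  let f := t.orderEmbOfFin ht
  have hsub : M.submatrix id f *ᵥ (v ∘ f) = 0 := by
    ext i
    have h : ∑ j, M i j * v j = 0 := congrFun hv i
    rw [← Finset.sum_subset t.subset_univ (fun j _ hj => by rw [hzero j hj, mul_zero]),
      ← Finset.map_orderEmbOfFin_univ t ht, Finset.sum_map] at h
    exact h
  have := Matrix.eq_zero_of_mulVec_eq_zero (hM f) hsub
  ext j
  by_cases hj : j ∈ t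
  · obtain ⟨i, rfl⟩ : j ∈ Set.range f := by rwa [Finset.range_orderEmbOfFin]
    exact congrFun this i
  · exact hzero j hj

theorem IsUniformMatrix.realMatrix {r s : ℕ} {M : Matrix (Fin r) (Fin s) ℤ}
    (hM : IsUniformMatrix M) : IsUniformMatrix (realMatrix M) := by
  intro f h
  refine hM f ?_
  rw [← Int.cast_inj (α := ℝ), Int.cast_zero, ← h, Int.cast_det]
  rfl

theorem IsGaleDual.mulVec_mulVec {r s t : ℕ} {M : Matrix (Fin r) (Fin s) ℝ}
    {N : Matrix (Fin s) (Fin t) ℝ} (h : IsGaleDual M N) (w : Fin t → ℝ) : M *ᵥ (N *ᵥ w) = 0 := by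
  have : N *ᵥ w ∈ LinearMap.ker M.mulVecLin := by
    rw [← h.2, ← Matrix.range_mulVecLin]
    exact ⟨w, rfl⟩
  exact this

theorem IsGaleDual.eq_zero_of_mulVec_eq_zero {r s t : ℕ} {M : Matrix (Fin r) (Fin s) ℝ}
    {N : Matrix (Fin s) (Fin t) ℝ} (h : IsGaleDual M N) {w : Fin t → ℝ} (hw : N *ᵥ w = 0) :
    w = 0 :=
  Matrix.mulVec_injective_iff.2 h.1 (by rw [hw, Matrix.mulVec_zero])

/-- Fewer than `t` rows of a Gale dual with `t` columns of a uniform matrix vanish at a given nonzero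
vector. -/
theorem IsGaleDual.card_lt_of_dotProduct_eq_zero {r s t : ℕ} {M : Matrix (Fin r) (Fin s) ℝ}
    {N : Matrix (Fin s) (Fin t) ℝ} (h : IsGaleDual M N) (hM : IsUniformMatrix M) (hs : s = r + t)
    {y : Fin t → ℝ} (hy : y ≠ 0) {R : Finset (Fin s)} (hR : ∀ i ∈ R, N i ⬝ᵥ y = 0) :
    R.card < t := by
  by_contra! hcard
  exact hy (h.eq_zero_of_mulVec_eq_zero (eq_zero_of_mulVec_eq_zero_of_isUniformMatrix hM
    (h.mulVec_mulVec y) hR (by omega) (by omega)))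

/-- A set of at most `t` rows of a Gale dual with `t` columns of a uniform matrix has at least as many
nonzero columns as rows. -/
theorem IsGaleDual.card_le_card_of_uniform {r s t : ℕ} {M : Matrix (Fin r) (Fin s) ℝ}
    {N : Matrix (Fin s) (Fin t) ℝ} (h : IsGaleDual M N) (hM : IsUniformMatrix M) (hs : s = r + t)
    {R : Finset (Fin s)} (hR : R.card ≤ t) {T : Finset (Fin t)}
    (hT : ∀ i ∈ R, ∀ j ∉ T, N i j = 0) : R.card ≤ T.card := by
  classical
  by_contra! hlt
  obtain ⟨R', hRR', hR'⟩ : ∃ R', R ⊆ R' ∧ R'.card = t :=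
    Finset.exists_superset_card_eq hR (by simp [hs])
  -- The target has dimension |T| + t - |R| < t. A kernel vector vanishes on T, hence is killed by
  -- the rows in R as well, so by all t rows in R'.
  let φ : (Fin t → ℝ) →ₗ[ℝ] (T → ℝ) × ((R' \ R : Finset _) → ℝ) :=
    (LinearMap.funLeft ℝ ℝ Subtype.val).prod
      ((LinearMap.funLeft ℝ ℝ Subtype.val).comp N.mulVecLin)
  have hker : LinearMap.ker φ ≠ ⊥ := by
    apply LinearMap.ker_ne_bot_of_finrank_lt
    simp only [Module.finrank_prod, Module.finrank_fintype_fun_eq_card, Fintype.card_coe,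
      Fintype.card_fin, Finset.card_sdiff_of_subset hRR']
    omega
  obtain ⟨w, hw, hw0⟩ := Submodule.exists_mem_ne_zero_of_ne_bot hker
  have hw' := Prod.ext_iff.1 (LinearMap.mem_ker.1 hw)
  have h1 : ∀ j ∈ T, w j = 0 := fun j hj => congrFun hw'.1 ⟨j, hj⟩
  have h2 : ∀ i ∈ R' \ R, N i ⬝ᵥ w = 0 := fun i hi => congrFun hw'.2 ⟨i, hi⟩
  have h3 : ∀ i ∈ R', N i ⬝ᵥ w = 0 := by
    intro i hi
    by_cases hiR : i ∈ R
    · refine Finset.sum_eq_zero fun j _ => ?_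
      by_cases hj : j ∈ T
      · rw [h1 j hj, mul_zero]
      · rw [hT i hiR j hj, zero_mul]
    · exact h2 i (by simp [hi, hiR])
  exact (h.card_lt_of_dotProduct_eq_zero hM hs hw0 h3).ne hR'

theorem galePolytope_closure_subset {n k : ℕ} (D : Matrix (Fin n) (Fin (k + 1)) ℝ) :
    closure (galePolytope D) ⊆ {y | y 0 = 1} :=
  closure_minimal Set.inter_subset_right (isClosed_eq (continuous_apply 0) continuous_const)

theorem card_le_of_mem_faceIndexSets {d k n : ℕ} (hn : n = d + 1 + k)
    {C : Matrix (Fin d) (Fin n) ℝ} (hC : IsUniformMatrix C)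
    {D : Matrix (Fin n) (Fin (k + 1)) ℝ} (hD : IsGaleDual C D) {R : Finset (Fin n)}
    (hR : (R : Set (Fin n)) ∈ faceIndexSets D) : R.card ≤ k := by
  obtain ⟨⟨i₀, hi₀⟩, -, ⟨y, hy⟩, -⟩ := hR
  rw [Set.mem_iInter₂] at hy
  have hy0 : y 0 = 1 := galePolytope_closure_subset D (hy i₀ hi₀).1
  have := hD.card_lt_of_dotProduct_eq_zero hC (by omega) (y := y)
    (fun h => by simp [h] at hy0) (R := R) (fun i hi => (hy i hi).2)
  omega

theorem span_intCast_image_closure {n : ℕ} (s : Set (Fin n → ℤ)) :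
    Submodule.span ℝ ((fun (u : Fin n → ℤ) i => (u i : ℝ)) '' AddSubgroup.closure s) =
      Submodule.span ℝ ((fun (u : Fin n → ℤ) i => (u i : ℝ)) '' s) := by
  apply le_antisymm
  · rw [Submodule.span_le]
    rintro _ ⟨u, hu, rfl⟩
    induction hu using AddSubgroup.closure_induction with
    | mem x hx => exact Submodule.subset_span ⟨x, hx, rfl⟩
    | zero =>
      have h : (fun i => (((0 : Fin n → ℤ) i : ℤ) : ℝ)) = 0 := by ext; simp
      change (fun i => (((0 : Fin n → ℤ) i : ℤ) : ℝ)) ∈ _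
      rw [h]
      exact zero_mem _
    | add x y _ _ hx hy =>
      convert! add_mem hx hy using 1
      ext; simp
    | neg x _ hx =>
      convert! neg_mem hx using 1
      ext; simp
  · exact Submodule.span_mono (Set.image_mono AddSubgroup.subset_closure)

theorem span_col_realMatrix {n k : ℕ} (B : Matrix (Fin n) (Fin k) ℤ) :
    Submodule.span ℝ (Set.range (realMatrix B).col) =
      Submodule.span ℝ ((fun (u : Fin n → ℤ) i => (u i : ℝ)) '' columnLattice B) := by
  rw [columnLattice, span_intCast_image_closure, ← Set.range_comp]
  rfl

theorem sum_eq_zero_of_mem_columnLattice {d k n : ℕ} {a : Fin n → Fin d → ℤ}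
    {B : Matrix (Fin n) (Fin k) ℤ} (hB : IsGaleDual (realMatrix (configMatrix a)) (realMatrix B))
    {u : Fin n → ℤ} (hu : u ∈ columnLattice B) : ∑ i, u i = 0 := by
  have hmem : (fun i => (u i : ℝ)) ∈ LinearMap.ker (realMatrix (configMatrix a)).mulVecLin := by
    rw [← hB.2, span_col_realMatrix]
    exact Submodule.subset_span ⟨u, hu, rfl⟩
  have h : ∑ i, realMatrix (configMatrix a) 0 i * (u i : ℝ) = 0 := congrFun hmem 0
  have h' : ∑ i, (u i : ℝ) = 0 := by
    simpa [realMatrix, configMatrix] using h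
  exact_mod_cast h'

/-- A lattice ideal that is a complete intersection is generated by binomials whose exponent vectors
are a basis of the lattice, and the number of these is the height. -/
theorem exists_basis_of_isCompleteIntersectionIdeal {d k n : ℕ} {a : Fin n → Fin d → ℤ}
    {B : Matrix (Fin n) (Fin k) ℤ} (hB : IsGaleDual (realMatrix (configMatrix a)) (realMatrix B))
    (hCI : IsCompleteIntersectionIdeal (latticeIdeal (columnLattice B))) :
    ∃ w : Fin k → Fin n → ℤ, (∀ j, w j ∈ columnLattice B) ∧
      Ideal.span (Set.range fun j => latticeBinomial (w j)) = latticeIdeal (columnLattice B) ∧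
      (k : ℕ∞) ≤ (latticeIdeal (columnLattice B)).height ∧
      AddSubgroup.closure (Set.range w) = columnLattice B := by
  obtain ⟨S, hS, hht⟩ := hCI
  have hrange : latticeIdeal (columnLattice B) =
      Ideal.span (Set.range fun u : columnLattice B => latticeBinomial (u : Fin n → ℤ)) := by
    rw [latticeIdeal]
    congr 1
    ext p
    simp [eq_comm]
  obtain ⟨c, e, hcS, he⟩ := MvPolynomial.exists_subfamily_span_eq
    (fun u : columnLattice B => latticeBinomial_isHomogeneous
      (sum_eq_zero_of_mem_columnLattice hB u.2)) S (hS.trans hrange)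
  have hSk : S.card ≤ k := by
    have h1 : (latticeIdeal (columnLattice B)).height ≤ (Set.range B.col).ncard :=
      height_latticeIdeal_closure_le (Set.finite_range _)
    rw [← hht] at h1
    have h2 : (Set.range B.col).ncard ≤ k := by
      rw [← Set.image_univ]
      exact (Set.ncard_image_le Set.finite_univ).trans (by simp)
    exact (by exact_mod_cast h1 : S.card ≤ _).trans h2
  have hcl : AddSubgroup.closure (Set.range fun j => (e j : Fin n → ℤ)) = columnLattice B := by
    apply le_antisymm
    · rw [AddSubgroup.closure_le]
      rintro _ ⟨j, rfl⟩
      exact (e j).2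
    · refine mem_closure_of_latticeIdeal_le_span ?_
      rw [hrange, ← he, ← Set.range_comp]
      exact le_rfl
  -- The c exponents span the column space of B, of dimension k.
  have hkc : k ≤ c := by
    have h1 : Module.finrank ℝ (Submodule.span ℝ (Set.range (realMatrix B).col)) = k := by
      rw [finrank_span_eq_card hB.1, Fintype.card_fin]
    rw [span_col_realMatrix, ← hcl, span_intCast_image_closure, ← Set.range_comp] at h1
    have h2 := finrank_range_le_card (R := ℝ)
      (b := (fun (u : Fin n → ℤ) i => (u i : ℝ)) ∘ fun j => (e j : Fin n → ℤ))
    rw [Set.finrank, h1, Fintype.card_fin] at h2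
    exact h2
  obtain rfl : c = k := by omega
  refine ⟨fun j => e j, fun j => (e j).2, by rw [hrange, ← he]; rfl, ?_, hcl⟩
  rw [← hht]
  exact_mod_cast hcS

end GaleDuality

theorem corollary6p2 {d k n : ℕ} (hk : 1 ≤ k) (hn : n = d + 1 + k)
    (a : Fin n → Fin d → ℤ) (hA : IsUniformMatrix (configMatrix a))
    (C : Matrix (Fin d) (Fin n) ℝ) (hC : IsUniformMatrix C)
    (hC0 : (0 : Fin d → ℝ) ∈ positiveColumnCone C)
    (B : Matrix (Fin n) (Fin k) ℤ)
    (hB : IsGaleDual (realMatrix (configMatrix a)) (realMatrix B))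
    (hCI : IsCompleteIntersectionIdeal (latticeIdeal (columnLattice B))) :
    ∃ B' : Matrix (Fin n) (Fin k) ℤ,
      IsGaleDual (realMatrix (configMatrix a)) (realMatrix B') ∧
      ∀ D : Matrix (Fin n) (Fin (k + 1)) ℝ, IsGaleDual C D →
        IsFullDimensionalGalePolytope D → Bornology.IsBounded (galePolytope D) →
        FaceSubmatricesNotWeaklyMixed (realMatrix B') D := by
  classical
  obtain ⟨w, hwL, hw, hht, hcl⟩ := exists_basis_of_isCompleteIntersectionIdeal hB hCI
  let B' : Matrix (Fin n) (Fin k) ℤ := Matrix.of fun i j => w j i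
  have hspan : Submodule.span ℝ (Set.range (realMatrix B').col) =
      Submodule.span ℝ (Set.range (realMatrix B).col) := by
    rw [span_col_realMatrix, span_col_realMatrix, ← hcl]
    rfl
  have hB' : IsGaleDual (realMatrix (configMatrix a)) (realMatrix B') := by
    refine ⟨?_, hspan.trans hB.2⟩
    rw [linearIndependent_iff_card_eq_finrank_span, Set.finrank, hspan, finrank_span_eq_card hB.1]
  refine ⟨B', hB', fun D hD _ _ L hL hmix => ?_⟩
  obtain ⟨R, rfl⟩ : ∃ R : Finset (Fin n), (R : Set (Fin n)) = L := ⟨L.toFinset, by simp⟩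
  let T : Finset (Fin k) := Finset.univ.filter fun j => ∃ i ∈ R, w j i ≠ 0
  have hRT : R.card ≤ T.card := by
    refine hB'.card_le_card_of_uniform hA.realMatrix hn (card_le_of_mem_faceIndexSets hn hC hD hL)
      fun i hi j hj => ?_
    have : w j i = 0 := by_contra fun h => hj (by simpa [T] using ⟨i, hi, h⟩)
    simp [B', this]
  refine hRT.not_gt (card_lt_card_of_mixed_of_height w hw hht R (by simpa using hL.1) T
    (fun j hj => ?_) fun j => sum_eq_zero_of_mem_columnLattice hB (hwL j))
  obtain ⟨i, hi, hij⟩ := (Finset.mem_filter.1 hj).2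
  rcases hmix j with h0 | ⟨⟨p, hp⟩, ⟨q, hq⟩⟩
  · exact absurd (h0 ⟨i, hi⟩) (by simpa [B'] using hij)
  · exact ⟨⟨p, p.2, by simpa [B'] using hp⟩, ⟨q, q.2, by simpa [B'] using hq⟩⟩
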